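/- Let $G$ be a compact, simply connected Lie group, realized as a subgroup of the invertible elements of $\mathrm{End}(\mathbb E)$ for a finite-dimensional Euclidean space $\mathbb E$, and equipped with a bi-invariant Riemannian metric; let $\mathfrak g\subset\mathrm{End}(\mathbb E)$ be its Lie algebra and $\mathfrak g=\mathfrak g_1\oplus\dots\oplus\mathfrak g_N$ its decomposition into simple ideals, with projections $\mathrm{pr}_{\mathfrak g_k}$. Let $H<G$ be a closed connected subgroup with Lie algebra $\mathfrak h$, let $M$ be a closed smooth $3$-manifold and let $\varphi:M\to G/H$ be a smooth map. For $m\in M$ with $\varphi(m)=gH$ put $\mathfrak h_{\varphi(m)}=g\,\mathfrak h\,g^{-1}$; for a $\mathfrak g$-valued $1$-form $a$ on $M$ let $a^{\Vert}$ and $a^{\bot}$ be its pointwise orthogonal projections to $\mathfrak h_{\varphi}$ and to its orthogonal complement $\mathfrak h_{\varphi}^{\bot}$ in $\mathfrak g$. Wedge products and $\mathrm{tr}$ are taken in $\mathrm{End}(\mathbb E)$. The form $a$ is called admissible if $$a^{\bot}\in L^2(\Lambda^1M\otimes\mathfrak g),\qquad a^{\bot}\wedge a^{\bot}\in L^2(\Lambda^2M\otimes\mathfrak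 g),\qquad a^{\Vert}\in W^{1,2}(\Lambda^1M\otimes\mathfrak g),$$ and a map $u\in W^{1,2}(M,G)$ (that is, $u\in W^{1,2}(M,\mathrm{End}(\mathbb E))$ with values in $G$) is called an admissible lift if $a=u^{-1}du$ is admissible, where $du$ is the weak differential. Let $c_1,\dots,c_N$ be real constants and let $$\Theta_{\mathfrak g_k}=c_k\,\mathrm{tr}\big(\mathrm{pr}_{\mathfrak g_k}(g^{-1}dg)\wedge\mathrm{pr}_{\mathfrak g_k}(g^{-1}dg)\wedge\mathrm{pr}_{\mathfrak g_k}(g^{-1}dg)\big),$$ a $3$-form on $G$. Let $u$ be an admissible lift, $a=u^{-1}du$, $a^{\Vert}_{\mathfrak g_k}=\mathrm{pr}_{\mathfrak g_k}(a^{\Vert})$, $a^{\bot}_{\mathfrak g_k}=\mathrm{pr}_{\mathfrak g_k}(a^{\bot})$, and define, almost everywhere on $M$, $$u^*\Theta_{\mathfrak g_k}:=c_k\Big(\mathrm{tr}(a^{\Vert}_{\mathfrak g_k}\wedge a^{\Vert}_{\mathfrak g_k}\wedge a^{\Vert}_{\mathfrak g_k})+3\,\mathrm{tr}(a^{\Vert}_{\mathfrak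 g_k}\wedge a^{\Vert}_{\mathfrak g_k}\wedge a^{\bot}_{\mathfrak g_k})+3\,\mathrm{tr}(a^{\Vert}_{\mathfrak g_k}\wedge a^{\bot}_{\mathfrak g_k}\wedge a^{\bot}_{\mathfrak g_k})+\mathrm{tr}(a^{\bot}_{\mathfrak g_k}\wedge a^{\bot}_{\mathfrak g_k}\wedge a^{\bot}_{\mathfrak g_k})\Big).$$ Then for every $k$ the form $u^*\Theta_{\mathfrak g_k}$ belongs to $L^1(\Lambda^3M)$. Moreover, if $u$ is smooth, it is equal (almost everywhere) to the usual pullback of the form $\Theta_{\mathfrak g_k}$ by $u$. -/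

import Mathlib

open MeasureTheory Set Filter Topology
open scoped Manifold ContDiff

/-! `End E` carries the commutator bracket. -/
attribute [local instance] LieRing.ofAssociativeRing

namespace FaddeevSkyrme

noncomputable section

/-! ### Matrix groups and their Lie algebras

`E` is a Euclidean space and groups are subgroups of the group of invertible elements of the
algebra `End E` of its (continuous) linear endomorphisms. -/

section LieAlgebra

variable {E : Type*} [NormedAddCommGroup E] [InnerProductSpace ℝ E]

/-- The point `g` of a subgroup `G` of `GL(E)`, as an element of `End E`. -/
abbrev toEnd {G : Subgroup (E →L[ℝ] E)ˣ} (g : G) : E →L[ℝ] E := ((g : (E →L[ℝ] E)ˣ) : E →L[ℝ] E)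

/-- `X` is a velocity vector at the point `g` of `G`: it is the derivative at `0` of a curve
in `G` that passes through `g` at time `0`. -/
def IsVelocity (G : Subgroup (E →L[ℝ] E)ˣ) (g : G) (X : E →L[ℝ] E) : Prop :=
  ∃ γ : ℝ → G, γ 0 = g ∧ HasDerivAt (fun t => toEnd (γ t)) X 0

theorem IsVelocity.translate {G : Subgroup (E →L[ℝ] E)ˣ} {g : G} {X : E →L[ℝ] E}
    (hX : IsVelocity G g X) (p q : G) :
    IsVelocity G (p * g * q) (toEnd p * X * toEnd q) := by
  obtain ⟨γ, h0, hγ⟩ := hX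
  refine ⟨fun t => p * γ t * q, by simp [h0], ?_⟩
  simpa [toEnd] using (hγ.const_mul (toEnd p)).mul_const (toEnd q)

theorem IsVelocity.add {G : Subgroup (E →L[ℝ] E)ˣ} {X Y : E →L[ℝ] E}
    (hX : IsVelocity G 1 X) (hY : IsVelocity G 1 Y) : IsVelocity G 1 (X + Y) := by
  obtain ⟨γ, h0, hγ⟩ := hX
  obtain ⟨δ, k0, hδ⟩ := hY
  refine ⟨fun t => γ t * δ t, by simp [h0, k0], ?_⟩
  have h := hγ.mul hδ
  simp only [h0, k0, toEnd, OneMemClass.coe_one, Units.val_one, one_mul, mul_one] at h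
  exact h

theorem IsVelocity.smul {G : Subgroup (E →L[ℝ] E)ˣ} {X : E →L[ℝ] E}
    (hX : IsVelocity G 1 X) (c : ℝ) : IsVelocity G 1 (c • X) := by
  obtain ⟨γ, h0, hγ⟩ := hX
  refine ⟨fun t => γ (c * t), by simp [h0], ?_⟩
  have h1 : HasDerivAt (fun t : ℝ => c * t) c 0 := by
    simpa using (hasDerivAt_id (0 : ℝ)).const_mul c
  have h2 : HasDerivAt (fun t => toEnd (γ t)) X (c * 0) := by simpa using hγ
  exact h2.scomp (0 : ℝ) h1

/-- The tangent space of `G` at the identity, as a linear subspace of `End E`. -/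
def tangentAtOne (G : Subgroup (E →L[ℝ] E)ˣ) : Submodule ℝ (E →L[ℝ] E) where
  carrier := {X | IsVelocity G 1 X}
  zero_mem' := ⟨fun _ => 1, rfl, by simpa using hasDerivAt_const (0 : ℝ) _⟩
  add_mem' hX hY := hX.add hY
  smul_mem' c _ hX := hX.smul c

theorem conj_mem_tangentAtOne {G : Subgroup (E →L[ℝ] E)ˣ} (g : G) {X : E →L[ℝ] E}
    (hX : X ∈ tangentAtOne G) : toEnd g * X * toEnd g⁻¹ ∈ tangentAtOne G := by
  have h := IsVelocity.translate (show IsVelocity G 1 X from hX) g g⁻¹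
  have h1 : g * 1 * g⁻¹ = 1 := by simp
  rw [h1] at h
  exact h

theorem isVelocity_iff {G : Subgroup (E →L[ℝ] E)ˣ} {g : G} {X : E →L[ℝ] E} :
    IsVelocity G g X ↔ toEnd g⁻¹ * X ∈ tangentAtOne G := by
  constructor
  · intro h
    have := h.translate g⁻¹ 1
    rw [inv_mul_cancel, one_mul] at this
    simpa [toEnd] using show toEnd g⁻¹ * X * toEnd (1 : G) ∈ tangentAtOne G from this
  · intro h
    have := IsVelocity.translate (show IsVelocity G 1 _ from h) g 1
    simpa [toEnd, ← mul_assoc] using this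

variable [FiniteDimensional ℝ E]

theorem lie_mem_tangentAtOne {G : Subgroup (E →L[ℝ] E)ˣ} {X Y : E →L[ℝ] E}
    (hX : X ∈ tangentAtOne G) (hY : Y ∈ tangentAtOne G) : ⁅X, Y⁆ ∈ tangentAtOne G := by
  obtain ⟨γ, h0, hγ⟩ := hX
  have hinv : HasDerivAt (fun t => toEnd (γ t)⁻¹) (-X) 0 := by
    have h := (hasFDerivAt_ringInverse ((γ 0 : G) : (E →L[ℝ] E)ˣ)).comp_hasDerivAt (0 : ℝ) hγ
    simp only [h0] at h
    refine (h.congr_of_eventuallyEq (Eventually.of_forall fun t => ?_)).congr_deriv ?_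
    · simp [toEnd]
    · simp
  have hc : HasDerivAt (fun t => toEnd (γ t) * Y * toEnd (γ t)⁻¹) ⁅X, Y⁆ 0 := by
    refine ((hγ.mul_const Y).mul hinv).congr_deriv ?_
    simp [h0, toEnd, Ring.lie_def, sub_eq_add_neg]
  have hclosed : IsClosed (tangentAtOne G : Set (E →L[ℝ] E)) :=
    (tangentAtOne G).closed_of_finiteDimensional
  have hs := hc.tendsto_slope
  refine hclosed.mem_of_tendsto hs (Eventually.of_forall fun t => ?_)
  exact (tangentAtOne G).smul_mem _
    ((tangentAtOne G).sub_mem (conj_mem_tangentAtOne (γ t) hY) (conj_mem_tangentAtOne (γ 0) hY))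

/-- The Lie algebra of `G`, a Lie subalgebra of `End E` with the commutator bracket. -/
def lieAlg (G : Subgroup (E →L[ℝ] E)ˣ) : LieSubalgebra ℝ (E →L[ℝ] E) :=
  { tangentAtOne G with lie_mem' := fun hX hY => lie_mem_tangentAtOne hX hY }

instance (G : Subgroup (E →L[ℝ] E)ˣ) : NormedAddCommGroup (lieAlg G) :=
  inferInstanceAs (NormedAddCommGroup (tangentAtOne G))

instance (G : Subgroup (E →L[ℝ] E)ˣ) : NormedSpace ℝ (lieAlg G) :=
  inferInstanceAs (NormedSpace ℝ (tangentAtOne G))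

instance (G : Subgroup (E →L[ℝ] E)ˣ) : FiniteDimensional ℝ (lieAlg G) :=
  inferInstanceAs (FiniteDimensional ℝ (tangentAtOne G))

/-- The inclusion of the Lie algebra of `G` into `End E`. -/
def incl (G : Subgroup (E →L[ℝ] E)ˣ) : lieAlg G →L[ℝ] (E →L[ℝ] E) :=
  (tangentAtOne G).subtypeL

/-- The adjoint action `Ad(g) X = g X g⁻¹` of `G` on its Lie algebra. -/
def Ad {G : Subgroup (E →L[ℝ] E)ˣ} (g : G) (X : lieAlg G) : lieAlg G :=
  ⟨toEnd g * (X : E →L[ℝ] E) * toEnd g⁻¹, conj_mem_tangentAtOne g X.2⟩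

/-- A bi-invariant Riemannian metric on `G`, given by the `Ad`-invariant inner product that it
induces on the Lie algebra. -/
structure BiInvariantMetric (G : Subgroup (E →L[ℝ] E)ˣ) where
  inner : LinearMap.BilinForm ℝ (lieAlg G)
  symm : ∀ X Y, inner X Y = inner Y X
  pos : ∀ X, X ≠ 0 → 0 < inner X X
  ad_invariant : ∀ (g : G) (X Y), inner (Ad g X) (Ad g Y) = inner X Y

/-- The isotropy subalgebra `𝔥_x` of a point `x = gH` of `G/H`, the set of all `ξ` with
`g⁻¹ ξ g` in the Lie algebra of `H` (for one representative `g` of `x`, equivalently for all of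
them). -/
def isotropy {G : Subgroup (E →L[ℝ] E)ˣ} (H : Subgroup G) (x : G ⧸ H) :
    Submodule ℝ (lieAlg G) where
  carrier := {ξ | ∀ g : G, (g : G ⧸ H) = x →
    ((Ad g⁻¹ ξ : lieAlg G) : E →L[ℝ] E) ∈ lieAlg (H.map G.subtype)}
  zero_mem' g _ := by
    simp [Ad]
  add_mem' {X Y} hX hY g hg := by
    have := (lieAlg (H.map G.subtype)).add_mem (hX g hg) (hY g hg)
    simpa [Ad, mul_add, add_mul] using this
  smul_mem' c X hX g hg := by
    have := (lieAlg (H.map G.subtype)).smul_mem c (hX g hg)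
    simpa [Ad] using this

theorem isCompl_orthogonal {G : Subgroup (E →L[ℝ] E)ˣ} (g : BiInvariantMetric G)
    (W : Submodule ℝ (lieAlg G)) : IsCompl W (g.inner.orthogonal W) := by
  have hrefl : g.inner.IsRefl := fun X Y h => by rw [g.symm]; exact h
  rw [LinearMap.BilinForm.isCompl_orthogonal_iff_disjoint hrefl, Submodule.disjoint_def]
  intro X hX hX'
  by_contra h0
  exact (g.pos X h0).ne' (hX' X hX)

/-- The orthogonal projection `𝔤 → 𝔥_x ⊆ 𝔤`. -/
def prPar {G : Subgroup (E →L[ℝ] E)ˣ} (g : BiInvariantMetric G) (H : Subgroup G) (x : G ⧸ H) :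
    lieAlg G →L[ℝ] lieAlg G :=
  LinearMap.toContinuousLinearMap
    ((isotropy H x).projection _ (isCompl_orthogonal g (isotropy H x)))

/-- The orthogonal projection `𝔤 → 𝔥_x^⊥ ⊆ 𝔤`. -/
def prPerp {G : Subgroup (E →L[ℝ] E)ˣ} (g : BiInvariantMetric G) (H : Subgroup G) (x : G ⧸ H) :
    lieAlg G →L[ℝ] lieAlg G :=
  LinearMap.toContinuousLinearMap
    ((g.inner.orthogonal (isotropy H x)).projection _ (isCompl_orthogonal g (isotropy H x)).symm)

/-- `𝔤 = ⨁ 𝔤ₖ` is the decomposition of the Lie algebra of `G` into its simple components. -/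
structure IsSimpleDecomposition (G : Subgroup (E →L[ℝ] E)ˣ) {ι : Type*} [DecidableEq ι]
    (𝔤 : ι → LieIdeal ℝ (lieAlg G)) : Prop where
  simple : ∀ k, LieAlgebra.IsSimple ℝ (𝔤 k)
  isInternal : DirectSum.IsInternal (fun k => (𝔤 k).toSubmodule)

/-- The projection `𝔤 → 𝔤ₖ ⊆ 𝔤` of the direct sum `𝔤 = ⨁ 𝔤ₖ` onto its `k`-th summand. -/
def prSimple {G : Subgroup (E →L[ℝ] E)ˣ} {ι : Type*} [DecidableEq ι]
    {𝔤 : ι → LieIdeal ℝ (lieAlg G)} (h𝔤 : IsSimpleDecomposition G 𝔤) (k : ι) :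
    lieAlg G →L[ℝ] lieAlg G :=
  LinearMap.toContinuousLinearMap ((𝔤 k).toSubmodule.subtype ∘ₗ
    DirectSum.component ℝ ι (fun k => (𝔤 k).toSubmodule) k ∘ₗ
    (LinearEquiv.ofBijective (DirectSum.coeLinearMap fun k => (𝔤 k).toSubmodule)
      h𝔤.isInternal).symm.toLinearMap)

/-- The trace on `End E`. -/
def traceL : (E →L[ℝ] E) →L[ℝ] ℝ :=
  LinearMap.toContinuousLinearMap
    (LinearMap.trace ℝ E ∘ₗ (ContinuousLinearMap.coeLM ℝ : (E →L[ℝ] E) →ₗ[ℝ] (E →ₗ[ℝ] E)))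

/-- The wedge product `α₀ ∧ ⋯ ∧ αₙ₋₁` of `1`-forms on a vector space `T` with values in the
algebra `End E`, built on the product of that algebra; for instance
`(α ∧ β)(v, w) = α(v) β(w) - α(w) β(v)`. -/
def wedge {T : Type*} [AddCommGroup T] [Module ℝ T] [TopologicalSpace T] {n : ℕ}
    (α : Fin n → (T →L[ℝ] (E →L[ℝ] E))) : T [⋀^Fin n]→L[ℝ] (E →L[ℝ] E) :=
  ((ContinuousMultilinearMap.mkPiAlgebraFin ℝ n (E →L[ℝ] E)).compContinuousLinearMap
    α).alternatization

/-- `tr (α ∧ β ∧ γ)` for three `1`-forms with values in the Lie algebra of `G`. -/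
def trWedge {G : Subgroup (E →L[ℝ] E)ˣ} {T : Type*} [AddCommGroup T] [Module ℝ T]
    [TopologicalSpace T] (α β γ : T →L[ℝ] lieAlg G) : T [⋀^Fin 3]→L[ℝ] ℝ :=
  traceL.compContinuousAlternatingMap
    (wedge ![(incl G).comp α, (incl G).comp β, (incl G).comp γ])

end LieAlgebra

/-! ### The group as a manifold, and the forms `Θₖ` on it -/

section MaurerCartan

variable {E : Type*} [NormedAddCommGroup E] [InnerProductSpace ℝ E] [FiniteDimensional ℝ E]

/-- The tangent space `T_g G`, as a linear subspace of `End E`: the set of the velocity vectors at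
`g` of curves in `G`. -/
def tangentAt (G : Subgroup (E →L[ℝ] E)ˣ) (g : G) : Submodule ℝ (E →L[ℝ] E) where
  carrier := {X | IsVelocity G g X}
  zero_mem' := isVelocity_iff.2 (by simp)
  add_mem' hX hY := isVelocity_iff.2 (by
    have := (tangentAtOne G).add_mem (isVelocity_iff.1 hX) (isVelocity_iff.1 hY)
    rwa [← mul_add] at this)
  smul_mem' c X hX := isVelocity_iff.2 (by
    have := (tangentAtOne G).smul_mem c (isVelocity_iff.1 hX)
    rwa [← mul_smul_comm] at this)

/-- The left-invariant Maurer-Cartan form `g⁻¹dg` of `G` at the point `g`. -/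
def maurerCartan (G : Subgroup (E →L[ℝ] E)ˣ) (g : G) : tangentAt G g →L[ℝ] lieAlg G :=
  ContinuousLinearMap.codRestrict
    ((ContinuousLinearMap.mul ℝ (E →L[ℝ] E) (toEnd g⁻¹)).comp (tangentAt G g).subtypeL)
    (tangentAtOne G) (fun X => isVelocity_iff.1 X.2)

/-- The `3`-form `Θₖ = cₖ tr (prₖ(g⁻¹dg) ∧ prₖ(g⁻¹dg) ∧ prₖ(g⁻¹dg))` on `G`, at the point `g`. -/
def Theta {G : Subgroup (E →L[ℝ] E)ˣ} {ι : Type*} [DecidableEq ι]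
    {𝔤 : ι → LieIdeal ℝ (lieAlg G)} (h𝔤 : IsSimpleDecomposition G 𝔤) (c : ι → ℝ) (k : ι) (g : G) :
    tangentAt G g [⋀^Fin 3]→L[ℝ] ℝ :=
  c k • trWedge ((prSimple h𝔤 k).comp (maurerCartan G g)) ((prSimple h𝔤 k).comp (maurerCartan G g))
    ((prSimple h𝔤 k).comp (maurerCartan G g))

end MaurerCartan

/-! ### Sobolev spaces of forms on a closed `3`-manifold -/

/-- The model space of `3`-manifolds. -/
abbrev R3 : Type := EuclideanSpace ℝ (Fin 3)

section Euclidean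

variable {W : Type*} [NormedAddCommGroup W] [NormedSpace ℝ W]

/-- `F ∈ L^p_loc(Ω)`: `F` is in `L^p(K)` for every compact subset `K` of `Ω`. -/
def MemLpLocOn (F : R3 → W) (p : ENNReal) (Ω : Set R3) : Prop :=
  ∀ K ⊆ Ω, IsCompact K → MemLp F p (volume.restrict K)

/-- `F'` is the weak derivative of `F` on the open set `Ω`. -/
structure HasWeakDerivOn (F : R3 → W) (F' : R3 → R3 →L[ℝ] W) (Ω : Set R3) : Prop where
  memLp : MemLpLocOn F 1 Ω
  memLp_deriv : MemLpLocOn F' 1 Ω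
  integral_eq : ∀ η : R3 → ℝ, ContDiff ℝ ∞ η → HasCompactSupport η → tsupport η ⊆ Ω →
    ∀ v : R3, ∫ y, (fderiv ℝ η y v) • F y = - ∫ y, η y • F' y v

/-- `F ∈ W^{1,2}_loc(Ω)`. -/
def MemW12LocOn (F : R3 → W) (Ω : Set R3) : Prop :=
  MemLpLocOn F 2 Ω ∧ ∃ F' : R3 → R3 →L[ℝ] W, HasWeakDerivOn F F' Ω ∧ MemLpLocOn F' 2 Ω

end Euclidean

section Manifold

variable {M : Type*} [TopologicalSpace M] [ChartedSpace R3 M]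
variable {V : Type*} [NormedAddCommGroup V] [NormedSpace ℝ V]

/-- (Not necessarily continuous) `1`-forms on `M` with values in `V`. -/
abbrev OneForm (M : Type*) [TopologicalSpace M] [ChartedSpace R3 M]
    (V : Type*) [NormedAddCommGroup V] [NormedSpace ℝ V] :=
  (x : M) → TangentSpace (𝓡 3) x →L[ℝ] V

/-- (Not necessarily continuous) `n`-forms on `M` with values in `V`. -/
abbrev Form (M : Type*) [TopologicalSpace M] [ChartedSpace R3 M] (n : ℕ)
    (V : Type*) [NormedAddCommGroup V] [NormedSpace ℝ V] :=
  (x : M) → TangentSpace (𝓡 3) x [⋀^Fin n]→L[ℝ] V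

/-- The smooth charts of `M`. -/
def charts (M : Type*) [TopologicalSpace M] [ChartedSpace R3 M] : Set (OpenPartialHomeomorph M R3) :=
  IsManifold.maximalAtlas (𝓡 3) ∞ M

/-- The `1`-form `α` in the coordinates of the chart `e`, i.e. its pullback by `e⁻¹`. -/
def OneForm.inChart (α : OneForm M V) (e : OpenPartialHomeomorph M R3) (y : R3) : R3 →L[ℝ] V :=
  (α (e.symm y)).comp (mfderiv (𝓡 3) (𝓡 3) e.symm y)

/-- The `n`-form `β` in the coordinates of the chart `e`, i.e. its pullback by `e⁻¹`. -/
def Form.inChart {n : ℕ} (β : Form M n V) (e : OpenPartialHomeomorph M R3) (y : R3) :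
    R3 [⋀^Fin n]→L[ℝ] V :=
  (β (e.symm y)).compContinuousLinearMap (mfderiv (𝓡 3) (𝓡 3) e.symm y)

/-- A property holds almost everywhere on `M`: the exceptional set is a null set in each chart. -/
def AEOn (P : M → Prop) : Prop :=
  ∀ e ∈ charts M, ∀ᵐ y ∂(volume.restrict e.target), P (e.symm y)

/-- `α ∈ L^p(Λ¹M ⊗ V)`, for a closed manifold `M`: the components of `α` are in `L^p` over every
compact subset of every chart. As `M` is compact, this is the `L^p` space of any Riemannian
metric on `M`. -/
def OneForm.MemL (α : OneForm M V) (p : ENNReal) : Prop :=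
  ∀ e ∈ charts M, MemLpLocOn (α.inChart e) p e.target

/-- `β ∈ L^p(ΛⁿM ⊗ V)`, for a closed manifold `M`. -/
def Form.MemL {n : ℕ} (β : Form M n V) (p : ENNReal) : Prop :=
  ∀ e ∈ charts M, MemLpLocOn (β.inChart e) p e.target

/-- `α ∈ W^{1,2}(Λ¹M ⊗ V)`, for a closed manifold `M`: in every chart the components of `α` are
in `L²` over compact sets, together with their weak derivatives. -/
def OneForm.MemW12 (α : OneForm M V) : Prop :=
  ∀ e ∈ charts M, MemW12LocOn (α.inChart e) e.target

/-- `f ∈ W^{1,2}(M, V)`, for a closed manifold `M`. -/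
def MemW12 (f : M → V) : Prop :=
  ∀ e ∈ charts M, MemW12LocOn (fun y => f (e.symm y)) e.target

/-- The `1`-form `α` is the weak differential `df` of the function `f` on `M`. -/
def HasWeakDifferential (f : M → V) (α : OneForm M V) : Prop :=
  ∀ e ∈ charts M, HasWeakDerivOn (fun y => f (e.symm y)) (α.inChart e) e.target

end Manifold

/-! ### Gauge potentials, admissible lifts and the extended pullback -/

section Gauge

variable {E : Type*} [NormedAddCommGroup E] [InnerProductSpace ℝ E] [FiniteDimensional ℝ E]
variable {G : Subgroup (E →L[ℝ] E)ˣ} {H : Subgroup G}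
variable {M : Type*} [TopologicalSpace M] [ChartedSpace R3 M]

/-- A map `u : M → G` is smooth: it is smooth as a map into `End E`, of which `G` is an embedded
submanifold. -/
def IsSmoothMap (u : M → G) : Prop :=
  ContMDiff (𝓡 3) 𝓘(ℝ, E →L[ℝ] E) ∞ (fun x => toEnd (u x))

/-- A map `φ : M → G/H` is smooth: locally it is the projection of smooth maps to `G`. -/
def IsSmoothCosetMap (φ : M → G ⧸ H) : Prop :=
  ∀ x : M, ∃ U : Set M, IsOpen U ∧ x ∈ U ∧ ∃ g : M → G,
    ContMDiffOn (𝓡 3) 𝓘(ℝ, E →L[ℝ] E) ∞ (fun y => toEnd (g y)) U ∧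
      ∀ y ∈ U, (g y : G ⧸ H) = φ y

/-- A `𝔤`-valued form, regarded as an `End E`-valued one. -/
def OneForm.toEnd (a : OneForm M (lieAlg G)) : OneForm M (E →L[ℝ] E) :=
  fun x => (incl G).comp (a x)

/-- The isotropic component `a^∥` of a gauge potential relative to `φ`. -/
def par (g : BiInvariantMetric G) (φ : M → G ⧸ H) (a : OneForm M (lieAlg G)) :
    OneForm M (lieAlg G) :=
  fun x => (prPar g H (φ x)).comp (a x)

/-- The coisotropic component `a^⊥` of a gauge potential relative to `φ`. -/
def perp (g : BiInvariantMetric G) (φ : M → G ⧸ H) (a : OneForm M (lieAlg G)) :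
    OneForm M (lieAlg G) :=
  fun x => (prPerp g H (φ x)).comp (a x)

/-- A gauge potential `a` is admissible relative to `φ`. -/
structure IsAdmissible (g : BiInvariantMetric G) (φ : M → G ⧸ H) (a : OneForm M (lieAlg G)) :
    Prop where
  perp_memL : (perp g φ a).MemL 2
  wedge_memL : Form.MemL (fun x => wedge ![(perp g φ a).toEnd x, (perp g φ a).toEnd x]) 2
  par_memW12 : (par g φ a).MemW12

/-- `a = u⁻¹du`, i.e. the weak differential of `u` is the product `u a`. -/
def IsPotentialOf (u : M → G) (a : OneForm M (lieAlg G)) : Prop :=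
  HasWeakDifferential (fun x => toEnd (u x))
    (fun x => (ContinuousLinearMap.mul ℝ (E →L[ℝ] E) (toEnd (u x))).comp (a.toEnd x))

/-- `u` is an admissible lift, with potential `a = u⁻¹du`: a Sobolev map `u ∈ W^{1,2}(M, G)` (the
values of a representative are taken in `G` at every point) whose potential is admissible. -/
structure IsAdmissibleLift (g : BiInvariantMetric G) (φ : M → G ⧸ H) (u : M → G)
    (a : OneForm M (lieAlg G)) : Prop where
  memW12 : MemW12 (fun x => toEnd (u x))
  potential : IsPotentialOf u a
  admissible : IsAdmissible g φ a

variable {ι : Type*} [DecidableEq ι] {𝔤 : ι → LieIdeal ℝ (lieAlg G)}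

/-- The form `u^*Θₖ` of an admissible lift `u` with potential `a = u⁻¹du`, defined by the expansion
`cₖ (tr(p∧p∧p) + 3 tr(p∧p∧q) + 3 tr(p∧q∧q) + tr(q∧q∧q))`, where `p`, `q` are the `𝔤ₖ`-components
of `a^∥` and `a^⊥`. -/
def extPullback (g : BiInvariantMetric G) (φ : M → G ⧸ H) (h𝔤 : IsSimpleDecomposition G 𝔤)
    (c : ι → ℝ) (k : ι) (a : OneForm M (lieAlg G)) : Form M 3 ℝ := fun x =>
  let p := (prSimple h𝔤 k).comp (par g φ a x)
  let q := (prSimple h𝔤 k).comp (perp g φ a x)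
  c k • (trWedge p p p + (3 : ℝ) • trWedge p p q + (3 : ℝ) • trWedge p q q + trWedge q q q)

theorem mfderiv_mem_tangentAt [IsManifold (𝓡 3) ∞ M] {u : M → G} (hu : IsSmoothMap u) (x : M)
    (v : TangentSpace (𝓡 3) x) :
    mfderiv (𝓡 3) 𝓘(ℝ, E →L[ℝ] E) (fun x => toEnd (u x)) x v ∈ tangentAt G (u x) := by
  have hd : MDifferentiableAt (𝓡 3) 𝓘(ℝ, E →L[ℝ] E) (fun x => toEnd (u x)) x :=
    (hu x).mdifferentiableAt (by simp)
  have h1 := hd.hasMFDerivAt.2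
  simp only [writtenInExtChartAt, extChartAt, chartAt_self_eq, mfld_simps] at h1
  set e := chartAt R3 x
  set L : R3 →L[ℝ] (E →L[ℝ] E) :=
    mfderiv (𝓡 3) 𝓘(ℝ, E →L[ℝ] E) (fun x => toEnd (u x)) x with hL
  let w : R3 := v
  have h2 : HasDerivAt (fun t : ℝ => e x + t • w) w 0 := by
    simpa using ((hasDerivAt_id (0 : ℝ)).smul_const w).const_add (e x)
  refine ⟨fun t => u (e.symm (e x + t • w)), ?_, ?_⟩
  · simp [e]
  · have h3 : HasFDerivAt (fun y => toEnd (u (e.symm y))) L (e x + (0 : ℝ) • w) := by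
      have h1' : HasFDerivWithinAt (fun y => toEnd (u (e.symm y))) L univ (e x) := h1
      rw [zero_smul, add_zero]
      exact hasFDerivWithinAt_univ.1 h1'
    exact h3.comp_hasDerivAt (0 : ℝ) h2

/-- The differential `T_x M → T_{u(x)} G` of a smooth map `u : M → G`. -/
def tangentMap [IsManifold (𝓡 3) ∞ M] {u : M → G} (hu : IsSmoothMap u) (x : M) :
    TangentSpace (𝓡 3) x →L[ℝ] tangentAt G (u x) :=
  ContinuousLinearMap.codRestrict
    (mfderiv (𝓡 3) 𝓘(ℝ, E →L[ℝ] E) (fun x => toEnd (u x)) x) (tangentAt G (u x))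
    (mfderiv_mem_tangentAt hu x)

/-- The pullback `u^*Ω` of a `3`-form `Ω` on `G` by a smooth map `u : M → G`. -/
def pullback [IsManifold (𝓡 3) ∞ M] {u : M → G} (hu : IsSmoothMap u)
    (Ω : (g : G) → tangentAt G g [⋀^Fin 3]→L[ℝ] ℝ) : Form M 3 ℝ :=
  fun x => (Ω (u x)).compContinuousLinearMap (tangentMap hu x)

end Gauge

end

end FaddeevSkyrme

open FaddeevSkyrme

/-! Let `p`, `q` be the `𝔤ₖ`-components of `a^∥`, `a^⊥`. Integrability is a local matter in charts,
where each of the four terms is a trace of a 1-form in `L²` wedged with a 2-form in `L²`, once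
`tr(p∧p∧q)` is rotated to `tr(q∧p∧p)`. The mixed product `p∧q`, about which nothing is known, never
has to be estimated.

That `p∧p` is in `L²` is the Sobolev embedding in dimension three: `a^∥` in `W^{1,2}` is locally in
`L⁶`, hence in `L⁴` (`MemW12LocOn.memLpLocOn_six`). That `q∧q` is in `L²` is algebra: the values of
`α∧α` are commutators `[α(v), α(w)]`, and the projection onto a simple ideal is a Lie algebra
homomorphism (`prSimple_lie`), so `q∧q` is a linear image of `a^⊥∧a^⊥`.

For smooth `u` the weak differential is a.e. the classical one, so `a` is the pullback of the
Maurer-Cartan form (`IsPotentialOf.ae_eq_maurerCartan`). Since `a^∥ + a^⊥ = a` and `trWedge` is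
cyclic, the four terms fold into the cube of `p + q` (`trWedge_add_self`), which is the usual
pullback. -/

namespace FaddeevSkyrme

/-! ### Young's inequality for mollifiers in `L²`. -/

section Convolution

variable {X : Type*} [NormedAddCommGroup X] [NormedSpace ℝ X] [FiniteDimensional ℝ X]
  [MeasurableSpace X] [BorelSpace X] {μ : Measure X} [μ.IsAddHaarMeasure]
variable {W : Type*} [NormedAddCommGroup W] [NormedSpace ℝ W]

/-- Convolution with a nonnegative kernel of mass at most one does not increase the `L²` norm. -/
theorem eLpNorm_two_convolution_le {ρ : X → ℝ} (hρ : AEStronglyMeasurable ρ μ)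
    (hmass : ∫⁻ t, ‖ρ t‖ₑ ∂μ ≤ 1) {F : X → W} (hF : AEStronglyMeasurable F μ) :
    eLpNorm (convolution ρ F (ContinuousLinearMap.lsmul ℝ ℝ) μ) 2 μ ≤ eLpNorm F 2 μ := by
  have hFm : AEMeasurable (fun p : X × X => ‖F (p.1 - p.2)‖ₑ) (μ.prod μ) :=
    (hF.comp_quasiMeasurePreserving (quasiMeasurePreserving_sub μ μ)).enorm
  have hρm : AEMeasurable (fun p : X × X => ‖ρ p.2‖ₑ) (μ.prod μ) :=
    hρ.comp_snd.enorm
  have hFx (x : X) : AEMeasurable (fun t => ‖F (x - t)‖ₑ) μ :=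
    (hF.comp_quasiMeasurePreserving (quasiMeasurePreserving_sub_left μ x)).enorm
  -- Jensen's inequality, by Cauchy-Schwarz for the splitting `|ρ||F| = |ρ|^{1/2} · (|ρ|^{1/2}|F|)`;
  -- the mass bound disposes of the first factor. Tonelli and translation invariance then give the
  -- claim.
  have key (x : X) : ‖convolution ρ F (ContinuousLinearMap.lsmul ℝ ℝ) μ x‖ₑ ^ (2 : ℝ) ≤
      ∫⁻ t, ‖ρ t‖ₑ * ‖F (x - t)‖ₑ ^ (2 : ℝ) ∂μ := by
    have h1 : ‖convolution ρ F (ContinuousLinearMap.lsmul ℝ ℝ) μ x‖ₑ ≤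
        ∫⁻ t, ‖ρ t‖ₑ * ‖F (x - t)‖ₑ ∂μ := by
      refine (enorm_integral_le_lintegral_enorm _).trans_eq ?_
      simp [enorm_smul]
    have h2 := ENNReal.lintegral_mul_le_Lp_mul_Lq μ (p := 2) (q := 2) ⟨by norm_num, by norm_num,
      by norm_num⟩ (f := fun t => ‖ρ t‖ₑ ^ (1 / 2 : ℝ))
      (g := fun t => ‖ρ t‖ₑ ^ (1 / 2 : ℝ) * ‖F (x - t)‖ₑ) (hρ.enorm.pow_const _)
      ((hρ.enorm.pow_const _).mul (hFx x))
    have h3 : ∀ r : ENNReal, r ^ (1 / 2 : ℝ) * r ^ (1 / 2 : ℝ) = r := fun r => by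
      rw [← ENNReal.rpow_add_of_nonneg _ _ (by norm_num) (by norm_num)]; norm_num
    have h4 : ∀ r : ENNReal, (r ^ (1 / 2 : ℝ)) ^ (2 : ℝ) = r := fun r => by
      rw [← ENNReal.rpow_mul]; norm_num
    simp only [Pi.mul_apply, ← mul_assoc, h3, h4,
      ENNReal.mul_rpow_of_nonneg _ _ (zero_le_two : (0 : ℝ) ≤ 2)] at h2
    have h5 := ENNReal.rpow_le_rpow (h1.trans (h2.trans (mul_le_mul_left (ENNReal.rpow_le_one hmass
      (by norm_num)) _))) (zero_le_two : (0 : ℝ) ≤ 2)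
    rwa [one_mul, h4] at h5
  rw [eLpNorm_eq_lintegral_rpow_enorm_toReal (by norm_num) (by norm_num),
    eLpNorm_eq_lintegral_rpow_enorm_toReal (by norm_num) (by norm_num)]
  simp only [ENNReal.toReal_ofNat]
  refine ENNReal.rpow_le_rpow ?_ (by norm_num)
  calc ∫⁻ x, ‖convolution ρ F (ContinuousLinearMap.lsmul ℝ ℝ) μ x‖ₑ ^ (2 : ℝ) ∂μ
      ≤ ∫⁻ x, ∫⁻ t, ‖ρ t‖ₑ * ‖F (x - t)‖ₑ ^ (2 : ℝ) ∂μ ∂μ := lintegral_mono key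
    _ = ∫⁻ t, ∫⁻ x, ‖ρ t‖ₑ * ‖F (x - t)‖ₑ ^ (2 : ℝ) ∂μ ∂μ :=
        lintegral_lintegral_swap (hρm.mul (hFm.pow_const _))
    _ = ∫⁻ t, ‖ρ t‖ₑ * ∫⁻ x, ‖F x‖ₑ ^ (2 : ℝ) ∂μ ∂μ := by
        refine lintegral_congr fun t => ?_
        rw [lintegral_const_mul' _ _ enorm_ne_top,
          lintegral_sub_right_eq_self (fun x => ‖F x‖ₑ ^ (2 : ℝ)) t]
    _ ≤ ∫⁻ x, ‖F x‖ₑ ^ (2 : ℝ) ∂μ := by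
        rw [lintegral_mul_const'' _ hρ.enorm]
        exact mul_le_of_le_one_left zero_le hmass

theorem ContDiffBump.lintegral_enorm_normed (f : ContDiffBump (0 : X)) :
    ∫⁻ t, ‖f.normed μ t‖ₑ ∂μ = 1 := by
  rw [← ofReal_integral_norm_eq_lintegral_enorm f.integrable_normed]
  simp [abs_of_nonneg (f.nonneg_normed _), f.integral_normed]

end Convolution

/-! ### Weak derivatives and the Sobolev embedding on open subsets of `ℝ³`. -/

section Sobolev

variable {W : Type*} [NormedAddCommGroup W] [NormedSpace ℝ W]

/-- The derivative of a mollification is the mollification of the weak derivative. -/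
theorem fderiv_convolution_of_weakDeriv {w : R3 → W} {w' : R3 → R3 →L[ℝ] W}
    (hw : LocallyIntegrable w) (hw' : LocallyIntegrable w')
    (hweak : ∀ η : R3 → ℝ, ContDiff ℝ ∞ η → HasCompactSupport η →
      ∀ v : R3, ∫ y, (fderiv ℝ η y v) • w y = - ∫ y, η y • w' y v)
    {ρ : R3 → ℝ} (hρ : ContDiff ℝ ∞ ρ) (hρc : HasCompactSupport ρ) :
    fderiv ℝ (convolution ρ w (ContinuousLinearMap.lsmul ℝ ℝ) volume) =
      convolution ρ w' (ContinuousLinearMap.lsmul ℝ ℝ) volume := by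
  funext x
  rw [(hρc.hasFDerivAt_convolution_left (ContinuousLinearMap.lsmul ℝ ℝ)
    (hρ.of_le (by simp)) hw x).fderiv]
  ext1 v
  have hd : Differentiable ℝ ρ := hρ.differentiable (by simp)
  -- The reflected translate of `ρ` is the test function; the sign produced by the reflection
  -- cancels the one in the definition of the weak derivative.
  have hη : ContDiff ℝ ∞ fun t => ρ (x - t) := hρ.comp (contDiff_const.sub contDiff_id)
  have hηc : HasCompactSupport fun t => ρ (x - t) :=
    hρc.comp_homeomorph (Homeomorph.subLeft x)
  have hder (t : R3) : fderiv ℝ (fun t => ρ (x - t)) t v = - fderiv ℝ ρ (x - t) v := by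
    have h1 : HasFDerivAt (fun t : R3 => x - t) (-ContinuousLinearMap.id ℝ R3) t :=
      (hasFDerivAt_id t).const_sub x
    have h2 : HasFDerivAt (fun t => ρ (x - t))
        ((fderiv ℝ ρ (x - t)).comp (-ContinuousLinearMap.id ℝ R3)) t :=
      (hd (x - t)).hasFDerivAt.comp t h1
    rw [h2.fderiv]
    simp
  have hi1 : Integrable fun t => ((ContinuousLinearMap.lsmul ℝ ℝ : ℝ →L[ℝ] W →L[ℝ] W).precompL R3
      (fderiv ℝ ρ t)) (w (x - t)) :=
    (hρc.fderiv ℝ).convolutionExists_left _ (hρ.continuous_fderiv (by simp)) hw x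
  have hi2 : Integrable fun t => (ContinuousLinearMap.lsmul ℝ ℝ : ℝ →L[ℝ] _ →L[ℝ] (R3 →L[ℝ] W))
      (ρ t) (w' (x - t)) :=
    hρc.convolutionExists_left _ hρ.continuous hw' x
  rw [convolution, convolution, ContinuousLinearMap.integral_apply hi1,
    ContinuousLinearMap.integral_apply hi2]
  rw [← integral_sub_left_eq_self _ _ x,
    ← integral_sub_left_eq_self (fun t => ((ContinuousLinearMap.lsmul ℝ ℝ (ρ t)) (w' (x - t))) v) _ x]
  have := hweak _ hη hηc v
  simp only [hder, neg_smul, integral_neg, neg_inj] at this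
  simpa using this

variable [FiniteDimensional ℝ W]

/-- The Sobolev inequality in dimension three, for weakly differentiable functions of compact
support. -/
theorem memLp_six_of_weakDeriv {w : R3 → W} {w' : R3 → R3 →L[ℝ] W}
    (hw : Integrable w) (hwc : HasCompactSupport w) (hw'2 : MemLp w' 2)
    (hweak : ∀ η : R3 → ℝ, ContDiff ℝ ∞ η → HasCompactSupport η →
      ∀ v : R3, ∫ y, (fderiv ℝ η y v) • w y = - ∫ y, η y • w' y v) :
    MemLp w 6 := by
  -- Shrinking bumps whose outer and inner radii keep the ratio 2: a bounded ratio is what a.e.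
  -- convergence of the mollifications requires.
  let φ : ℕ → ContDiffBump (0 : R3) := fun n =>
    ⟨1 / (n + 1), 2 * (1 / (n + 1)), by positivity,
      by linarith [show (0 : ℝ) < 1 / ((n : ℝ) + 1) by positivity]⟩
  let wn : ℕ → R3 → W := fun n =>
    convolution ((φ n).normed volume) w (ContinuousLinearMap.lsmul ℝ ℝ) volume
  have hw'l : LocallyIntegrable w' := hw'2.locallyIntegrable (by norm_num)
  have hsm (n : ℕ) : ContDiff ℝ 1 (wn n) :=
    (φ n).hasCompactSupport_normed.contDiff_convolution_left (n := 1)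
      (ContinuousLinearMap.lsmul ℝ ℝ) (φ n).contDiff_normed hw.locallyIntegrable
  have hcs (n : ℕ) : HasCompactSupport (wn n) :=
    HasCompactSupport.convolution _ (φ n).hasCompactSupport_normed hwc
  have hlim : ∀ᵐ x, Tendsto (fun n => wn n x) atTop (𝓝 (w x)) := by
    refine ContDiffBump.ae_convolution_tendsto_right_of_locallyIntegrable (K := 2) ?_
      (Eventually.of_forall fun n => le_rfl) hw.locallyIntegrable
    simpa [φ] using (tendsto_one_div_add_atTop_nhds_zero_nat (𝕜 := ℝ)).const_mul 2
  -- Gagliardo-Nirenberg-Sobolev with `1/6 = 1/2 - 1/3`. The bound is uniform in `n` because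
  -- mollifying `w'` does not increase its `L²` norm.
  have hbound (n : ℕ) : eLpNorm (wn n) 6 volume ≤
      SNormLESNormFDerivOfEqConst W (volume : Measure R3) (2 : NNReal) * eLpNorm w' 2 volume := by
    have h := eLpNorm_le_eLpNorm_fderiv_of_eq (volume : Measure R3) (hsm n) (hcs n) (p := 2)
      (p' := 6) (by norm_num) (by simp) (by simp; norm_num)
    refine h.trans (mul_le_mul_right ?_ _)
    rw [fderiv_convolution_of_weakDeriv hw.locallyIntegrable hw'l hweak (φ n).contDiff_normed
      (φ n).hasCompactSupport_normed]
    exact eLpNorm_two_convolution_le (φ n).continuous_normed.aestronglyMeasurable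
      (ContDiffBump.lintegral_enorm_normed _).le hw'2.1
  -- Fatou's lemma carries the uniform bound to the a.e. limit `w`.
  refine ⟨hw.1, (Lp.eLpNorm_lim_le_liminf_eLpNorm
    (fun n => (hsm n).continuous.aestronglyMeasurable) w hlim).trans_lt ?_⟩
  refine (liminf_le_of_le (by isBoundedDefault) (a := SNormLESNormFDerivOfEqConst W
    (volume : Measure R3) (2 : NNReal) * eLpNorm w' 2 volume) fun b hb => ?_).trans_lt
    (ENNReal.mul_lt_top ENNReal.coe_lt_top hw'2.2)
  obtain ⟨n, hn⟩ := hb.exists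
  exact hn.trans (hbound n)

theorem exists_contDiff_eq_one_of_isCompact {K Ω : Set R3} (hK : IsCompact K) (hΩ : IsOpen Ω)
    (hKΩ : K ⊆ Ω) : ∃ χ : R3 → ℝ, ContDiff ℝ ∞ χ ∧ HasCompactSupport χ ∧ tsupport χ ⊆ Ω ∧
      ∀ x ∈ K, χ x = 1 := by
  obtain ⟨L, hL, hKL, hLΩ⟩ := exists_compact_between hK hΩ hKΩ
  obtain ⟨χ, hχ, -, hsupp, hone⟩ := exists_contMDiff_support_eq_eq_one_iff (𝓡 3) (n := ⊤)
    isOpen_interior hK.isClosed hKL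
  have hsub : tsupport χ ⊆ L := by
    rw [tsupport, hsupp]
    exact closure_minimal interior_subset hL.isClosed
  exact ⟨χ, hχ.contDiff, hL.of_isClosed_subset (isClosed_tsupport _) hsub, hsub.trans hLΩ,
    fun x hx => (hone x).1 hx⟩

/-- The product vanishes off the compact set `tsupport χ ⊆ Ω`, so local integrability on `Ω` becomes
global and the values of `F` outside `Ω` play no role. -/
theorem MemLpLocOn.memLp_smul {V : Type*} [NormedAddCommGroup V] [NormedSpace ℝ V] {F : R3 → V}
    {p : ENNReal} {Ω : Set R3} (hF : MemLpLocOn F p Ω) {χ : R3 → ℝ} (hχ : Continuous χ)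
    (hχc : HasCompactSupport χ) (hχΩ : tsupport χ ⊆ Ω) : MemLp (fun y => χ y • F y) p := by
  obtain ⟨C, hC⟩ := hχc.exists_bound_of_continuous hχ
  have h := (hF _ hχΩ hχc).smul (p := ⊤) (r := p)
    (memLp_top_of_bound hχ.aestronglyMeasurable C (Eventually.of_forall hC))
  rw [← memLp_indicator_iff_restrict (isClosed_tsupport χ).measurableSet] at h
  rwa [indicator_eq_self.2] at h
  intro y hy
  by_contra hy'
  exact hy (by simp [image_eq_zero_of_notMem_tsupport hy'])

theorem MemLpLocOn.mono_exponent {V : Type*} [NormedAddCommGroup V] [NormedSpace ℝ V] {F : R3 → V}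
    {p q : ENNReal} {Ω : Set R3} (hF : MemLpLocOn F p Ω) (hqp : q ≤ p) : MemLpLocOn F q Ω := by
  intro K hK hKc
  have : IsFiniteMeasure (volume.restrict K) := ⟨by simpa using hKc.measure_lt_top⟩
  exact (hF K hK hKc).mono_exponent hqp

theorem MemLpLocOn.clm_comp {V V' : Type*} [NormedAddCommGroup V] [NormedSpace ℝ V]
    [NormedAddCommGroup V'] [NormedSpace ℝ V'] {F : R3 → V} {p : ENNReal} {Ω : Set R3}
    (hF : MemLpLocOn F p Ω) (L : V →L[ℝ] V') : MemLpLocOn (fun y => L (F y)) p Ω :=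
  fun K hK hKc => L.comp_memLp' (hF K hK hKc)

/-- The Sobolev embedding `W^{1,2}_loc ⊆ L^6_loc` in dimension three. -/
theorem MemW12LocOn.memLpLocOn_six {F : R3 → W} {Ω : Set R3} (hΩ : IsOpen Ω)
    (hF : MemW12LocOn F Ω) : MemLpLocOn F 6 Ω := by
  intro K hK hKc
  obtain ⟨hF2, F', hweak, hF'2⟩ := hF
  obtain ⟨χ, hχ, hχc, hχΩ, hone⟩ := exists_contDiff_eq_one_of_isCompact hKc hΩ hK
  have hdχ : ∀ v : R3, ContDiff ℝ ∞ fun y => fderiv ℝ χ y v := fun v =>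
    (hχ.fderiv_right (m := ∞) (by simp)).clm_apply contDiff_const
  have hF1 : MemLpLocOn F 1 Ω := hweak.memLp
  have hF'1 : MemLpLocOn F' 1 Ω := hweak.memLp_deriv
  have hw : MemLp (fun y => χ y • F y) 1 := hF1.memLp_smul hχ.continuous hχc hχΩ
  have hsub (v : R3) : tsupport (fun y => fderiv ℝ χ y v) ⊆ tsupport χ :=
    closure_minimal (fun y hy => by
      refine support_fderiv_subset ℝ (f := χ) fun h0 => hy ?_
      simp [h0]) (isClosed_tsupport _)
  have hcs (v : R3) : HasCompactSupport fun y => fderiv ℝ χ y v :=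
    hχc.of_isClosed_subset (isClosed_tsupport _) (hsub v)
  -- The product rule: this is the weak derivative of `χ F`.
  let w' : R3 → R3 →L[ℝ] W := fun y => (fderiv ℝ χ y).smulRight (F y) + χ y • F' y
  have hw'2 : MemLp w' 2 := by
    refine MemLp.add ?_ (hF'2.memLp_smul hχ.continuous hχc hχΩ)
    -- In coordinates `dχ ⊗ F` is a sum of scalar cutoffs `∂ᵢχ` times `F`, to which
    -- `MemLpLocOn.memLp_smul` applies.
    have h1 : (fun y => (fderiv ℝ χ y).smulRight (F y)) = fun y => ∑ i : Fin 3,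
        (EuclideanSpace.proj i : R3 →L[ℝ] ℝ).smulRight
          (fderiv ℝ χ y (EuclideanSpace.single i 1) • F y) := by
      funext y
      refine ContinuousLinearMap.coe_injective
        ((EuclideanSpace.basisFun (Fin 3) ℝ).toBasis.ext fun j => ?_)
      simp [PiLp.single_apply]
    rw [h1]
    refine memLp_finsetSum _ fun i _ => ?_
    exact (ContinuousLinearMap.smulRightL ℝ R3 W (EuclideanSpace.proj i)).comp_memLp'
      (hF2.memLp_smul (hdχ (EuclideanSpace.single i 1)).continuous (hcs _) ((hsub _).trans hχΩ))
  have h6 : MemLp (fun y => χ y • F y) 6 := by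
    refine memLp_six_of_weakDeriv (memLp_one_iff_integrable.1 hw) ?_ hw'2 ?_
    · exact hχc.smul_right
    · intro η hη hηc v
      have hηχ : tsupport (fun y => η y * χ y) ⊆ Ω :=
        (tsupport_mul_subset_right (f := η) (g := χ)).trans hχΩ
      -- `η` need not be supported in `Ω`, but `η χ` is, so it can be tested against `F`.
      have h := hweak.integral_eq (fun y => η y * χ y) (hη.mul hχ) hχc.mul_left hηχ v
      have hder (y : R3) : fderiv ℝ (fun y => η y * χ y) y v =
          η y * fderiv ℝ χ y v + χ y * fderiv ℝ η y v := by
        rw [fderiv_fun_mul (hη.differentiable (by simp) y) (hχ.differentiable (by simp) y)]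
        simp
      have hi1 : Integrable fun y => (η y * fderiv ℝ χ y v) • F y :=
        memLp_one_iff_integrable.1 (hF1.memLp_smul (hη.mul (hdχ v)).continuous (hcs v).mul_left
          (((tsupport_mul_subset_right (f := η) (g := fun y => fderiv ℝ χ y v)).trans
            (hsub v)).trans hχΩ))
      have hdη : Continuous fun y => fderiv ℝ η y v :=
        (hη.continuous_fderiv (by simp)).clm_apply continuous_const
      have hi2 : Integrable fun y => (χ y * fderiv ℝ η y v) • F y :=
        memLp_one_iff_integrable.1 (hF1.memLp_smul (hχ.continuous.mul hdη) hχc.mul_right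
          ((tsupport_mul_subset_left (f := χ)).trans hχΩ))
      have hi3 : Integrable fun y => (η y * χ y) • F' y v :=
        memLp_one_iff_integrable.1 ((hF'1.clm_comp (ContinuousLinearMap.apply ℝ W v)).memLp_smul
          (hη.mul hχ).continuous hχc.mul_left hηχ)
      simp only [hder, add_smul] at h
      rw [integral_add hi1 hi2] at h
      have e1 : ∫ y, fderiv ℝ η y v • χ y • F y = ∫ y, (χ y * fderiv ℝ η y v) • F y := by
        simp only [smul_smul, mul_comm]
      have e2 : ∫ y, η y • w' y v =
          (∫ y, (η y * fderiv ℝ χ y v) • F y) + ∫ y, (η y * χ y) • F' y v := by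
        rw [← integral_add hi1 hi3]
        simp [w', smul_add, smul_smul]
      rw [e1, e2, neg_add, ← h]
      abel
  refine (h6.restrict K).ae_eq ?_
  filter_upwards [ae_restrict_mem hKc.measurableSet] with y hy
  simp [hone y hy]

/-- A weak derivative of a function that is smooth on an open set is its derivative there. -/
theorem HasWeakDerivOn.ae_eq_fderiv {F : R3 → W} {F' : R3 → R3 →L[ℝ] W} {Ω : Set R3}
    (hΩ : IsOpen Ω) (hF : HasWeakDerivOn F F' Ω) (hsm : ContDiffOn ℝ 1 F Ω) :
    ∀ᵐ y ∂(volume.restrict Ω), F' y = fderiv ℝ F y := by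
  have hdc : ContinuousOn (fderiv ℝ F) Ω := hsm.continuousOn_fderiv_of_isOpen hΩ le_rfl
  have hv (v : R3) : ∀ᵐ y, y ∈ Ω → F' y v - fderiv ℝ F y v = 0 := by
    have hl' : LocallyIntegrableOn (fun y => F' y v) Ω :=
      (locallyIntegrableOn_iff hΩ.isLocallyClosed).2 fun K hK hKc =>
        memLp_one_iff_integrable.1 (hF.memLp_deriv.clm_comp (ContinuousLinearMap.apply ℝ W v) K hK hKc)
    have hl : LocallyIntegrableOn (fun y => fderiv ℝ F y v) Ω :=
      (hdc.clm_apply continuousOn_const).locallyIntegrableOn hΩ.measurableSet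
    -- Fundamental lemma of the calculus of variations: the weak and the classical integration by
    -- parts give the same integrals against every test function.
    refine hΩ.ae_eq_zero_of_integral_contDiff_smul_eq_zero (hl'.sub hl) fun η hη hηc hηΩ => ?_
    have hp (η : R3 → ℝ) (hη : Continuous η) (hηc : HasCompactSupport η) (hηΩ : tsupport η ⊆ Ω)
        {G : R3 → W} (hG : LocallyIntegrableOn G Ω) : Integrable fun y => η y • G y := by
      have hG1 : MemLpLocOn G 1 Ω := fun K hK hKc => by
        have hGK : IntegrableOn G K := hG.integrableOn_compact_subset hK hKc
        exact memLp_one_iff_integrable.2 hGK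
      exact memLp_one_iff_integrable.1 (hG1.memLp_smul hη hηc hηΩ)
    have hlF : LocallyIntegrableOn F Ω := hsm.continuousOn.locallyIntegrableOn hΩ.measurableSet
    have hdη : Continuous fun y => fderiv ℝ η y v :=
      (hη.continuous_fderiv (by simp)).clm_apply continuous_const
    have hdsub : tsupport (fun y => fderiv ℝ η y v) ⊆ tsupport η :=
      closure_minimal (fun y hy => by
        refine support_fderiv_subset ℝ (f := η) fun h0 => hy ?_
        simp [h0]) (isClosed_tsupport _)
    have h1 := hF.integral_eq η hη hηc hηΩ v
    have h2 := integral_smul_fderiv_eq_neg_fderiv_smul_of_integrable (𝕜 := ℝ) (μ := volume)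
      (f := η) (g := F) (v := v)
      (hp _ hdη (hηc.of_isClosed_subset (isClosed_tsupport _) hdsub) (hdsub.trans hηΩ) hlF)
      (hp _ hη.continuous hηc hηΩ hl) (hp _ hη.continuous hηc hηΩ hlF)
      (fun x _ => hη.differentiable (by simp) x)
      (fun x hx => (hsm.differentiableOn one_ne_zero).differentiableAt (hΩ.mem_nhds (hηΩ hx)))
    simp only [smul_sub]
    rw [integral_sub (hp _ hη.continuous hηc hηΩ hl') (hp _ hη.continuous hηc hηΩ hl), h2, h1,
      neg_neg, sub_self]
  rw [ae_restrict_iff' hΩ.measurableSet]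
  -- The null set depends on the direction `v`, so only the three basis directions are used.
  have hall := ae_all_iff.2 fun i : Fin 3 => hv (EuclideanSpace.basisFun (Fin 3) ℝ i)
  filter_upwards [hall] with y hy hyΩ
  exact ContinuousLinearMap.coe_injective
    ((EuclideanSpace.basisFun (Fin 3) ℝ).toBasis.ext fun j => by
      simpa using sub_eq_zero.1 (hy j hyΩ))

end Sobolev

/-! ### Identities for `tr(α∧β∧γ)`. -/

section Algebra

variable {E : Type*} [NormedAddCommGroup E] [InnerProductSpace ℝ E]
variable {T : Type*} [AddCommGroup T] [Module ℝ T] [TopologicalSpace T]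

theorem wedge_two_apply (α β : T →L[ℝ] (E →L[ℝ] E)) (v : Fin 2 → T) :
    wedge ![α, β] v = α (v 0) * β (v 1) - α (v 1) * β (v 0) := by
  have hu : (Finset.univ : Finset (Equiv.Perm (Fin 2))) = {1, Equiv.swap 0 1} := by decide
  simp only [wedge, ContinuousMultilinearMap.alternatization_apply_apply]
  rw [hu, Finset.sum_insert (by decide), Finset.sum_singleton]
  simp [sub_eq_add_neg]

variable [FiniteDimensional ℝ E] {G : Subgroup (E →L[ℝ] E)ˣ}

theorem traceL_mul_cycle (A B C : E →L[ℝ] E) : traceL (A * B * C) = traceL (C * A * B) :=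
  LinearMap.trace_mul_cycle ℝ (A : E →ₗ[ℝ] E) (B : E →ₗ[ℝ] E) (C : E →ₗ[ℝ] E)

/-- The six permutations are grouped by their first factor, so that `β` and `γ` enter only through
the values of `β∧γ`. The integrability estimate depends on this form. -/
theorem trWedge_apply (α β γ : T →L[ℝ] lieAlg G) (v : Fin 3 → T) :
    trWedge α β γ v =
      traceL (incl G (α (v 0)) * (incl G (β (v 1)) * incl G (γ (v 2)) -
        incl G (β (v 2)) * incl G (γ (v 1)))) +
      traceL (incl G (α (v 1)) * (incl G (β (v 2)) * incl G (γ (v 0)) -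
        incl G (β (v 0)) * incl G (γ (v 2)))) +
      traceL (incl G (α (v 2)) * (incl G (β (v 0)) * incl G (γ (v 1)) -
        incl G (β (v 1)) * incl G (γ (v 0)))) := by
  have hu : (Finset.univ : Finset (Equiv.Perm (Fin 3))) =
    {1, Equiv.swap 1 2, Equiv.swap 0 1 * Equiv.swap 1 2, Equiv.swap 0 1,
      Equiv.swap 1 2 * Equiv.swap 0 1, Equiv.swap 0 2} := by decide
  have h1 : (Equiv.swap 0 1 : Equiv.Perm (Fin 3)) 2 = 2 := by decide
  have h2 : (Equiv.swap 0 2 : Equiv.Perm (Fin 3)) 1 = 1 := by decide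
  have h3 : (Equiv.swap 1 2 : Equiv.Perm (Fin 3)) 0 = 0 := by decide
  have hs : (Equiv.Perm.sign (Equiv.swap (0 : Fin 3) 1) = -1) ∧
    (Equiv.Perm.sign (Equiv.swap (0 : Fin 3) 2) = -1) ∧
    (Equiv.Perm.sign (Equiv.swap (1 : Fin 3) 2) = -1) := by decide
  simp only [trWedge, wedge, ContinuousLinearMap.compContinuousAlternatingMap_coe,
    Function.comp_apply, ContinuousMultilinearMap.alternatization_apply_apply]
  rw [hu, Finset.sum_insert (by decide), Finset.sum_insert (by decide),
    Finset.sum_insert (by decide), Finset.sum_insert (by decide), Finset.sum_insert (by decide),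
    Finset.sum_singleton]
  simp [h1, h2, h3, hs, mul_sub]
  ring

theorem trWedge_comp {T' : Type*} [AddCommGroup T'] [Module ℝ T'] [TopologicalSpace T']
    (α β γ : T →L[ℝ] lieAlg G) (D : T' →L[ℝ] T) :
    (trWedge α β γ).compContinuousLinearMap D =
      trWedge (α.comp D) (β.comp D) (γ.comp D) := by
  ext v
  simp [trWedge_apply]

/-- A 3-cycle is even, so rotating the 1-forms costs no sign, and the trace absorbs the rotation of
the matrices. -/
theorem trWedge_cycle (α β γ : T →L[ℝ] lieAlg G) : trWedge α β γ = trWedge γ α β := by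
  ext v
  simp only [trWedge_apply, mul_sub, map_sub, ← mul_assoc,
    fun i j k => traceL_mul_cycle (incl G (α (v i))) (incl G (β (v j))) (incl G (γ (v k)))]
  ring

theorem trWedge_add_left (α α' β γ : T →L[ℝ] lieAlg G) :
    trWedge (α + α') β γ = trWedge α β γ + trWedge α' β γ := by
  ext v
  simp only [trWedge_apply, ContinuousAlternatingMap.add_apply, add_apply, map_add, add_mul]
  ring

theorem trWedge_add_self (p q : T →L[ℝ] lieAlg G) :
    trWedge (p + q) (p + q) (p + q) =
      trWedge p p p + (3 : ℝ) • trWedge p p q + (3 : ℝ) • trWedge p q q + trWedge q q q := by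
  -- Additivity in the other two slots follows from the first one by rotation. Of the eight terms of
  -- the cube, the mixed ones then agree in threes.
  have hm (α β β' γ : T →L[ℝ] lieAlg G) :
      trWedge α (β + β') γ = trWedge α β γ + trWedge α β' γ := by
    rw [← trWedge_cycle, trWedge_add_left, trWedge_cycle β, trWedge_cycle β']
  have hr (α β γ γ' : T →L[ℝ] lieAlg G) :
      trWedge α β (γ + γ') = trWedge α β γ + trWedge α β γ' := by
    rw [trWedge_cycle, trWedge_add_left, ← trWedge_cycle α β γ, ← trWedge_cycle α β γ']
  rw [trWedge_add_left, hm, hm, hr, hr, hr, hr, trWedge_cycle p q p, trWedge_cycle q q p,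
    trWedge_cycle q p q, trWedge_cycle q q p, ← trWedge_cycle p p q]
  module

end Algebra

/-! ### Projections onto the simple ideals. -/

section SimpleProjection

variable {E : Type*} [NormedAddCommGroup E] [InnerProductSpace ℝ E] [FiniteDimensional ℝ E]
variable {G : Subgroup (E →L[ℝ] E)ˣ}
variable {ι : Type*} [DecidableEq ι] {𝔤 : ι → LieIdeal ℝ (lieAlg G)}

theorem prSimple_mem (h𝔤 : IsSimpleDecomposition G 𝔤) (k : ι) (x : lieAlg G) :
    prSimple h𝔤 k x ∈ 𝔤 k :=
  Subtype.prop (p := fun x => x ∈ 𝔤 k) _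

theorem prSimple_of_mem (h𝔤 : IsSimpleDecomposition G 𝔤) (k : ι) {x : lieAlg G} {j : ι}
    (hx : x ∈ 𝔤 j) : prSimple h𝔤 k x = if j = k then x else 0 := by
  change (((LinearEquiv.ofBijective (DirectSum.coeLinearMap fun k => (𝔤 k).toSubmodule)
      h𝔤.isInternal).symm x k : (𝔤 k).toSubmodule) : lieAlg G) = _
  split_ifs with h
  · subst h
    rw [h𝔤.isInternal.ofBijective_coeLinearMap_of_mem hx]
  · rw [h𝔤.isInternal.ofBijective_coeLinearMap_of_mem_ne h hx]
    rfl

theorem sum_prSimple [Fintype ι] (h𝔤 : IsSimpleDecomposition G 𝔤) (x : lieAlg G) :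
    ∑ k, prSimple h𝔤 k x = x := by
  let e := LinearEquiv.ofBijective (DirectSum.coeLinearMap fun k => (𝔤 k).toSubmodule)
    h𝔤.isInternal
  have h1 : DirectSum.coeLinearMap (fun k => (𝔤 k).toSubmodule) (e.symm x) = x :=
    e.apply_symm_apply x
  rw [← DirectSum.sum_univ_of (e.symm x), map_sum] at h1
  simp only [DirectSum.coeLinearMap_of] at h1
  exact h1

/-- The bracket of elements of `𝔤ᵢ` and `𝔤ⱼ` lies in both ideals, so its `k`-th component vanishes
unless `i = j = k`. Expanding `x` and `y` into components leaves the single term `(k, k)`. -/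
theorem prSimple_lie [Fintype ι] (h𝔤 : IsSimpleDecomposition G 𝔤) (k : ι) (x y : lieAlg G) :
    prSimple h𝔤 k ⁅x, y⁆ = ⁅prSimple h𝔤 k x, prSimple h𝔤 k y⁆ := by
  have hij (i j : ι) : prSimple h𝔤 k ⁅prSimple h𝔤 i x, prSimple h𝔤 j y⁆ =
      if i = k ∧ j = k then ⁅prSimple h𝔤 i x, prSimple h𝔤 j y⁆ else 0 := by
    have hi := prSimple_of_mem h𝔤 k (lie_mem_left ℝ _ (𝔤 i) _ (prSimple h𝔤 j y)
      (prSimple_mem h𝔤 i x))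
    have hj := prSimple_of_mem h𝔤 k (lie_mem_right ℝ _ (𝔤 j) (prSimple h𝔤 i x) _
      (prSimple_mem h𝔤 j y))
    split_ifs with h
    · rw [hi, if_pos h.1]
    · rcases not_and_or.1 h with h | h
      · rw [hi, if_neg h]
      · rw [hj, if_neg h]
  conv_lhs => rw [← sum_prSimple h𝔤 x, ← sum_prSimple h𝔤 y]
  simp only [sum_lie, lie_sum, map_sum, hij]
  rw [Finset.sum_eq_single k, Finset.sum_eq_single k] <;> simp +contextual

theorem incl_lie (x y : lieAlg G) : incl G ⁅x, y⁆ = incl G x * incl G y - incl G y * incl G x :=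
  rfl

end SimpleProjection

/-! ### Hölder estimates for the four terms. -/

/-- The integrability of a field of `3`-covectors of `ℝ³` can be tested on a basis. -/
theorem memLp_of_memLp_apply {f : R3 → R3 [⋀^Fin 3]→L[ℝ] ℝ} {p : ENNReal} {μ : Measure R3}
    (hf : ∀ v : Fin 3 → R3, MemLp (fun y => f y v) p μ) : MemLp f p μ := by
  let b := (EuclideanSpace.basisFun (Fin 3) ℝ).toBasis
  have hdet (y : R3) (v : Fin 3 → R3) : f y v = f y b * b.det v := by
    have h := AlternatingMap.eq_smul_basis_det b (f y).toAlternatingMap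
    exact congrArg (fun F : R3 [⋀^Fin 3]→ₗ[ℝ] ℝ => F v) h
  -- Forms of top degree are a line. A continuous generator is any value of `f` that is nonzero on
  -- `b`, normalised; if there is none, `f = 0`.
  obtain ⟨θ, hθ⟩ : ∃ θ : R3 [⋀^Fin 3]→L[ℝ] ℝ, ∀ y, f y = f y b • θ := by
    by_cases h0 : ∃ y₀, f y₀ b ≠ 0
    · obtain ⟨y₀, h0⟩ := h0
      refine ⟨(f y₀ b)⁻¹ • f y₀, fun y => ?_⟩
      ext v
      simp only [ContinuousAlternatingMap.smul_apply, smul_eq_mul]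
      rw [hdet y v, hdet y₀ v]
      field_simp
    · push Not at h0
      refine ⟨0, fun y => ?_⟩
      ext v
      simp [hdet y v, h0 y]
  rw [funext hθ]
  exact (ContinuousLinearMap.toSpanSingleton ℝ θ).comp_memLp' (hf b)

section Integrability

variable {E : Type*} [NormedAddCommGroup E] [InnerProductSpace ℝ E] [FiniteDimensional ℝ E]
variable {G : Subgroup (E →L[ℝ] E)ˣ} {μ : Measure R3}

theorem memLp_incl_apply {α : R3 → R3 →L[ℝ] lieAlg G} {p : ENNReal} (hα : MemLp α p μ) (v : R3) :
    MemLp (fun y => incl G (α y v)) p μ :=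
  ((incl G).comp (ContinuousLinearMap.apply ℝ (lieAlg G) v)).comp_memLp' hα

/-- The values of `tr (α ∧ β ∧ γ)` are integrable as soon as `α` and `β ∧ γ` are square integrable. -/
theorem memLp_one_trWedge {α β γ : R3 → R3 →L[ℝ] lieAlg G} (hα : MemLp α 2 μ)
    (hβγ : ∀ v w : R3, MemLp (fun y => incl G (β y v) * incl G (γ y w) -
      incl G (β y w) * incl G (γ y v)) 2 μ) (v : Fin 3 → R3) :
    MemLp (fun y => trWedge (α y) (β y) (γ y) v) 1 μ := by
  have h (i j k : Fin 3) : MemLp (fun y => traceL (incl G (α y (v i)) *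
      (incl G (β y (v j)) * incl G (γ y (v k)) - incl G (β y (v k)) * incl G (γ y (v j))))) 1 μ := by
    -- Hölder with `1/2 + 1/2 = 1`. The second factor is a value of `β∧γ`, taken as a whole: `β` and
    -- `γ` need not be integrable separately.
    have h1 : MemLp (fun y => incl G (α y (v i)) *
        (incl G (β y (v j)) * incl G (γ y (v k)) - incl G (β y (v k)) * incl G (γ y (v j)))) 1 μ :=
      MemLp.mul (hβγ (v j) (v k)) (memLp_incl_apply hα (v i))
    exact ContinuousLinearMap.comp_memLp' (traceL (E := E)) h1
  simp only [trWedge_apply]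
  exact ((h 0 1 2).add (h 1 2 0)).add (h 2 0 1)

theorem memLp_two_wedge_of_memLp_four {β γ : R3 → R3 →L[ℝ] lieAlg G} (hβ : MemLp β 4 μ)
    (hγ : MemLp γ 4 μ) (v w : R3) :
    MemLp (fun y => incl G (β y v) * incl G (γ y w) - incl G (β y w) * incl G (γ y v)) 2 μ := by
  have : ENNReal.HolderTriple 4 4 2 := ⟨by
    have h : (4 : ENNReal) = 2 * 2 := by norm_num
    rw [h, ENNReal.mul_inv (by simp) (by simp), ← mul_add, ENNReal.inv_two_add_inv_two, mul_one]⟩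
  exact (MemLp.mul (memLp_incl_apply hγ w) (memLp_incl_apply hβ v)).sub
    (MemLp.mul (memLp_incl_apply hγ v) (memLp_incl_apply hβ w))

/-- The expansion of `tr ((p + q) ∧ (p + q) ∧ (p + q))` is integrable if `p` is in `L² ∩ L⁴` and
`q` and `q ∧ q` are square integrable. -/
theorem memLp_one_expansion {p q : R3 → R3 →L[ℝ] lieAlg G} (hp : MemLp p 2 μ)
    (hp4 : MemLp p 4 μ) (hq : MemLp q 2 μ)
    (hqq : ∀ v w : R3, MemLp (fun y => incl G (q y v) * incl G (q y w) -
      incl G (q y w) * incl G (q y v)) 2 μ) (c : ℝ) :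
    MemLp (fun y => c • (trWedge (p y) (p y) (p y) + (3 : ℝ) • trWedge (p y) (p y) (q y) +
      (3 : ℝ) • trWedge (p y) (q y) (q y) + trWedge (q y) (q y) (q y))) 1 μ := by
  have hpp := memLp_two_wedge_of_memLp_four hp4 hp4
  refine memLp_of_memLp_apply fun v => ?_
  -- Moving `q` to the front leaves `p∧p` behind it, so only `p∧p` and `q∧q` occur as 2-form
  -- factors.
  have heq (p q : R3 →L[ℝ] lieAlg G) : (c • (trWedge p p p + (3 : ℝ) • trWedge p p q +
      (3 : ℝ) • trWedge p q q + trWedge q q q)) v = c * (trWedge p p p v + 3 * trWedge q p p v +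
        3 * trWedge p q q v + trWedge q q q v) := by
    rw [trWedge_cycle p p q]
    rfl
  simp only [heq]
  have h1 := memLp_one_trWedge hp hpp v
  have h2 := (memLp_one_trWedge hq hpp v).const_mul 3
  have h3 := (memLp_one_trWedge hp hqq v).const_mul 3
  have h4 := memLp_one_trWedge hq hqq v
  exact (((h1.add h2).add h3).add h4).const_mul c

variable {ι : Type*} [Fintype ι] [DecidableEq ι] {𝔤 : ι → LieIdeal ℝ (lieAlg G)}

/-- The projection to a simple component preserves the square integrability of `β ∧ β`. -/
theorem memLp_wedge_prSimple (h𝔤 : IsSimpleDecomposition G 𝔤) (k : ι)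
    {β : R3 → R3 →L[ℝ] lieAlg G} {p : ENNReal} {v w : R3}
    (hβ : MemLp (fun y => incl G (β y v) * incl G (β y w) - incl G (β y w) * incl G (β y v)) p μ) :
    MemLp (fun y => incl G (prSimple h𝔤 k (β y v)) * incl G (prSimple h𝔤 k (β y w)) -
      incl G (prSimple h𝔤 k (β y w)) * incl G (prSimple h𝔤 k (β y v))) p μ := by
  -- The hypothesis concerns `End E`-valued commutators. A linear retraction `r` of `End E` onto `𝔤`
  -- makes the passage to `𝔤ₖ` a fixed continuous linear map applied to them.
  obtain ⟨r, hr⟩ := (incl G).toLinearMap.exists_leftInverse_of_injective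
    (LinearMap.ker_eq_bot.2 Subtype.val_injective)
  have hr' (x : lieAlg G) : LinearMap.toContinuousLinearMap r (incl G x) = x :=
    LinearMap.congr_fun hr x
  have h := ((incl G).comp ((prSimple h𝔤 k).comp
    (LinearMap.toContinuousLinearMap r))).comp_memLp' hβ
  simpa only [Function.comp_def, ← incl_lie, ContinuousLinearMap.comp_apply, hr', prSimple_lie]
    using h

end Integrability

/-! ### The extended pullback on the manifold. -/

section ExtPullback

variable {E : Type*} [NormedAddCommGroup E] [InnerProductSpace ℝ E] [FiniteDimensional ℝ E]
variable {G : Subgroup (E →L[ℝ] E)ˣ} {H : Subgroup G} (g : BiInvariantMetric G)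
variable {M : Type*} [TopologicalSpace M] [ChartedSpace R3 M] {φ : M → G ⧸ H}
variable {ι : Type*} [DecidableEq ι] {𝔤 : ι → LieIdeal ℝ (lieAlg G)}

theorem inChart_wedge_apply (α : OneForm M (lieAlg G)) (e : OpenPartialHomeomorph M R3) (y : R3)
    (v : Fin 2 → R3) :
    Form.inChart (fun x => wedge ![α.toEnd x, α.toEnd x]) e y v =
      incl G (α.inChart e y (v 0)) * incl G (α.inChart e y (v 1)) -
        incl G (α.inChart e y (v 1)) * incl G (α.inChart e y (v 0)) :=
  wedge_two_apply (α.toEnd (e.symm y)) (α.toEnd (e.symm y))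
    (fun i => mfderiv (𝓡 3) (𝓡 3) e.symm y (v i))

theorem inChart_extPullback (h𝔤 : IsSimpleDecomposition G 𝔤) (c : ι → ℝ) (k : ι)
    (a : OneForm M (lieAlg G)) (e : OpenPartialHomeomorph M R3) (y : R3) :
    (extPullback g φ h𝔤 c k a).inChart e y =
      let p := (prSimple h𝔤 k).comp ((par g φ a).inChart e y)
      let q := (prSimple h𝔤 k).comp ((perp g φ a).inChart e y)
      c k • (trWedge p p p + (3 : ℝ) • trWedge p p q + (3 : ℝ) • trWedge p q q + trWedge q q q) := by
  let D : R3 →L[ℝ] TangentSpace (𝓡 3) (e.symm y) := mfderiv (𝓡 3) (𝓡 3) e.symm y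
  let p := (prSimple h𝔤 k).comp (par g φ a (e.symm y))
  let q := (prSimple h𝔤 k).comp (perp g φ a (e.symm y))
  have h1 := trWedge_comp p p p D
  have h2 := trWedge_comp p p q D
  have h3 := trWedge_comp p q q D
  have h4 := trWedge_comp q q q D
  change (c k • (trWedge p p p + (3 : ℝ) • trWedge p p q + (3 : ℝ) • trWedge p q q +
    trWedge q q q)).compContinuousLinearMap D = c k • (trWedge (p.comp D) (p.comp D) (p.comp D) +
      (3 : ℝ) • trWedge (p.comp D) (p.comp D) (q.comp D) +
      (3 : ℝ) • trWedge (p.comp D) (q.comp D) (q.comp D) +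
      trWedge (q.comp D) (q.comp D) (q.comp D))
  rw [← h1, ← h2, ← h3, ← h4]
  rfl

theorem extPullback_memL [Fintype ι] {a : OneForm M (lieAlg G)} (ha : IsAdmissible g φ a)
    (h𝔤 : IsSimpleDecomposition G 𝔤) (c : ι → ℝ) (k : ι) :
    (extPullback g φ h𝔤 c k a).MemL 1 := by
  intro e he K hK hKc
  -- On compact sets `L⁶` contains no less than is needed: it embeds into both `L²` and `L⁴`.
  have hP : MemLpLocOn ((par g φ a).inChart e) 6 e.target :=
    (ha.par_memW12 e he).memLpLocOn_six e.open_target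
  rw [funext (inChart_extPullback g h𝔤 c k a e)]
  let L := ContinuousLinearMap.compL ℝ R3 (lieAlg G) (lieAlg G) (prSimple h𝔤 k)
  refine memLp_one_expansion (p := fun y => (prSimple h𝔤 k).comp ((par g φ a).inChart e y))
    (q := fun y => (prSimple h𝔤 k).comp ((perp g φ a).inChart e y))
    (L.comp_memLp' (hP.mono_exponent (by norm_num) K hK hKc))
    (L.comp_memLp' (hP.mono_exponent (by norm_num) K hK hKc))
    (L.comp_memLp' (ha.perp_memL e he K hK hKc)) (fun v w => ?_) (c k)
  refine memLp_wedge_prSimple h𝔤 k (β := (perp g φ a).inChart e) ?_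
  have h := (ContinuousAlternatingMap.apply ℝ R3 (E →L[ℝ] E) ![v, w]).comp_memLp'
    (ha.wedge_memL e he K hK hKc)
  exact (memLp_congr_ae (Eventually.of_forall fun y =>
    inChart_wedge_apply (perp g φ a) e y ![v, w])).1 h

theorem par_add_perp (a : OneForm M (lieAlg G)) (x : M) : par g φ a x + perp g φ a x = a x := by
  ext1 v
  exact Submodule.projection_add_projection_eq_self
    (isCompl_orthogonal g (isotropy H (φ x))) (a x v)

variable [IsManifold (𝓡 3) ∞ M]

/-- The potential of a smooth lift is the pullback of the Maurer-Cartan form. -/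
theorem IsPotentialOf.ae_eq_maurerCartan {u : M → G} {a : OneForm M (lieAlg G)}
    (ha : IsPotentialOf u a) (hu : IsSmoothMap u) :
    AEOn fun x => a x = (maurerCartan G (u x)).comp (tangentMap hu x) := by
  intro e he
  have hsymm : ContMDiffOn (𝓡 3) (𝓡 3) ∞ e.symm e.target := contMDiffOn_symm_of_mem_maximalAtlas he
  have hemd : e.MDifferentiable (𝓡 3) (𝓡 3) :=
    ⟨(contMDiffOn_of_mem_maximalAtlas he).mdifferentiableOn (by simp),
      hsymm.mdifferentiableOn (by simp)⟩
  have hsm : ContDiffOn ℝ 1 (fun y => toEnd (u (e.symm y))) e.target :=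
    (contMDiffOn_iff_contDiffOn.1 (hu.comp_contMDiffOn hsymm)).of_le (by simp)
  filter_upwards [(ha e he).ae_eq_fderiv e.open_target hsm,
    ae_restrict_mem e.open_target.measurableSet] with y hy hyt
  have hchain : fderiv ℝ (fun y => toEnd (u (e.symm y))) y =
      (mfderiv (𝓡 3) 𝓘(ℝ, E →L[ℝ] E) (fun x => toEnd (u x)) (e.symm y)).comp
        (mfderiv (𝓡 3) (𝓡 3) e.symm y) := by
    rw [← mfderiv_eq_fderiv]
    exact mfderiv_comp y ((hu _).mdifferentiableAt (by simp))
      (hemd.mdifferentiableAt_symm hyt)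
  rw [hchain] at hy
  refine ContinuousLinearMap.ext fun v => Subtype.ext ?_
  -- The identity is known only on coordinate vectors; these reach every tangent vector because the
  -- differential of the inverse chart is onto. Multiplication by `u⁻¹` then isolates `a`.
  obtain ⟨w, rfl⟩ := hemd.symm.mfderiv_surjective hyt v
  have hw : toEnd (u (e.symm y))⁻¹ * (toEnd (u (e.symm y)) *
      incl G (a (e.symm y) (mfderiv (𝓡 3) (𝓡 3) e.symm y w))) = toEnd (u (e.symm y))⁻¹ *
        (show E →L[ℝ] E from mfderiv (𝓡 3) 𝓘(ℝ, E →L[ℝ] E) (fun x => toEnd (u x)) (e.symm y)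
          (mfderiv (𝓡 3) (𝓡 3) e.symm y w)) :=
    congrArg (fun L : R3 →L[ℝ] (E →L[ℝ] E) => toEnd (u (e.symm y))⁻¹ * L w) hy
  have hinv : toEnd (u (e.symm y))⁻¹ * toEnd (u (e.symm y)) = 1 := by simp [toEnd]
  rw [← mul_assoc, hinv, one_mul] at hw
  exact hw

/-- Pointwise algebra: `p + q` is the `𝔤ₖ`-component of `a`, so the expansion is the cube of the
pulled-back Maurer-Cartan form, and pullback commutes with `trWedge`. -/
theorem extPullback_eq_pullback {u : M → G} {a : OneForm M (lieAlg G)} (hu : IsSmoothMap u)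
    (h𝔤 : IsSimpleDecomposition G 𝔤) (c : ι → ℝ) (k : ι) {x : M}
    (hx : a x = (maurerCartan G (u x)).comp (tangentMap hu x)) :
    extPullback g φ h𝔤 c k a x = pullback hu (Theta h𝔤 c k) x := by
  rw [pullback, Theta, extPullback, ← trWedge_add_self, ← ContinuousLinearMap.comp_add,
    par_add_perp, hx]
  have h := trWedge_comp ((prSimple h𝔤 k).comp (maurerCartan G (u x)))
    ((prSimple h𝔤 k).comp (maurerCartan G (u x))) ((prSimple h𝔤 k).comp (maurerCartan G (u x)))
    (tangentMap hu x)
  exact congrArg (c k • ·) h.symm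

end ExtPullback

end FaddeevSkyrme

theorem lemmaL
    {E : Type*} [NormedAddCommGroup E] [InnerProductSpace ℝ E] [FiniteDimensional ℝ E]
    (G : Subgroup (E →L[ℝ] E)ˣ) (hG : IsCompact (G : Set (E →L[ℝ] E)ˣ)) [SimplyConnectedSpace G]
    (H : Subgroup G) (hHclosed : IsClosed (H : Set G)) (hHconn : IsConnected (H : Set G))
    (g : BiInvariantMetric G)
    {ι : Type*} [Fintype ι] [DecidableEq ι] {𝔤 : ι → LieIdeal ℝ (lieAlg G)}
    (h𝔤 : IsSimpleDecomposition G 𝔤) (c : ι → ℝ)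
    {M : Type*} [TopologicalSpace M] [T2Space M] [CompactSpace M] [ChartedSpace R3 M]
    [IsManifold (𝓡 3) ∞ M]
    (φ : M → G ⧸ H) (hφ : IsSmoothCosetMap φ)
    (u : M → G) (a : OneForm M (lieAlg G)) (hu : IsAdmissibleLift g φ u a) (k : ι) :
    (extPullback g φ h𝔤 c k a).MemL 1 ∧
      ∀ husmooth : IsSmoothMap u,
        AEOn fun x => extPullback g φ h𝔤 c k a x = pullback husmooth (Theta h𝔤 c k) x := by
  refine ⟨extPullback_memL g hu.admissible h𝔤 c k, fun husmooth e he => ?_⟩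
  filter_upwards [hu.potential.ae_eq_maurerCartan husmooth e he] with y hy
  exact extPullback_eq_pullback g husmooth h𝔤 c k hy
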